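/- Let $n\in\mathbb N$ and let $\mathcal C^n$ be the family of all $n$-dimensional closed convex subsets of $\mathbb R^n$. Let $f\in\mathbb R^n\setminus\mathbb Z^n$. For $B\in\mathcal C^n$ with $f\in\operatorname{int}(B)$, let $\psi_{B-f}(r):=\inf\{\lambda>0: r\in\lambda(B-f)\}$ for $r\in\mathbb R^n$. For $B\in\mathcal C^n$ and $R=(r_1,\dots,r_k)\in\mathbb R^{n\times k}$, $k\ge 1$, let $$C_B(R,f):=\Big\{s\in\mathbb R^k_{\ge0}:\ \sum_{i=1}^k s_i\,\psi_{B-f}(r_i)\ge 1\Big\}\ \text{ if } f\in\operatorname{int}(B),\qquad C_B(R,f):=\mathbb R^k_{\ge0}\ \text{ otherwise.}$$ For $\mathcal B\subseteq\mathcal C^n$ let $C_{\mathcal B}(R,f):=\bigcap_{B\in\mathcal B}C_B(R,f)$, with $C_{\emptyset}(R,f):=\mathbb R^k_{\ge0}$. For $L\in\mathcal C^n$ define, as infima in $[0,\infty]$ (with $\inf\emptyset=\infty$), $$\rho_f(B,L):=\inf\{\alpha>0:\ C_B(R,f)\subseteq\tfrac1\alpha C_L(R,f)\ \text{ for all } R\},\qquad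 \rho_f(\mathcal B,L):=\inf\{\alpha>0:\ C_{\mathcal B}(R,f)\subseteq\tfrac1\alpha C_L(R,f)\ \text{ for all } R\},$$ where $R$ ranges over $\bigcup_{k\ge1}\mathbb R^{n\times k}$. The family $\mathcal B$ is called $f$-closed if $\{\psi_{B-f}: B\in\mathcal B,\ f\in\operatorname{int}(B)\}$ is closed, with respect to pointwise convergence, within $\{\psi_{C-f}: C\in\mathcal C^n,\ f\in\operatorname{int}(C)\}$. **Theorem.** Let $f\in\mathbb R^n\setminus\mathbb Z^n$, let $\mathcal B\subseteq\mathcal C^n$ be $f$-closed, and let $L\in\mathcal C^n$ be a polyhedron $L=\operatorname{conv}(V)+\operatorname{cone}(W)$, where $V\subseteq\mathbb R^n$ is finite and nonempty and $W\subseteq\mathbb R^n\setminus\{0\}$ is finite (possibly empty, with $\operatorname{cone}(\emptyset)=\{0\}$). Assume that $\mathcal B\neq\emptyset$ or $f\in\operatorname{int}(L)$. Then $$\frac{1}{|V|+|W|+1}\,\inf_{B\in\mathcal B}\rho_f(B,L)\ \le\ \rho_f(\mathcal B,L)\ \le\ \inf_{B\in\mathcal B}\rho_f(B,L).$$ -/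

import Mathlib

open scoped Pointwise

namespace OneForAll

/-- The integer lattice `ℤⁿ` as a subset of `ℝⁿ`. -/
def integerPoints (n : ℕ) : Set (EuclideanSpace ℝ (Fin n)) :=
  {x | ∀ i, ∃ z : ℤ, x i = z}

/-- The family `𝒞ⁿ` of all `n`-dimensional, closed, convex subsets of `ℝⁿ`; a subset of `ℝⁿ` is
`n`-dimensional when its affine hull is `ℝⁿ`. -/
def bodies (n : ℕ) : Set (Set (EuclideanSpace ℝ (Fin n))) :=
  {C | IsClosed C ∧ Convex ℝ C ∧ affineSpan ℝ C = ⊤}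

/-- The subfamily `𝓑_f` of all members of `𝓑` that contain `f` in the interior. -/
def containing {n : ℕ} (𝓑 : Set (Set (EuclideanSpace ℝ (Fin n))))
    (f : EuclideanSpace ℝ (Fin n)) : Set (Set (EuclideanSpace ℝ (Fin n))) :=
  {B ∈ 𝓑 | f ∈ interior B}

/-- The gauge function `ψ_{B - f}`, that is `r ↦ inf {t > 0 | r ∈ t (B - f)}`. It is only used
for `f ∈ interior B`, where the infimum is over a nonempty set. -/
noncomputable def gaugeAt {n : ℕ} (B : Set (EuclideanSpace ℝ (Fin n)))
    (f : EuclideanSpace ℝ (Fin n)) : EuclideanSpace ℝ (Fin n) → ℝ :=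
  gauge ((fun x => x - f) '' B)

/-- The family of gauge functions `{ψ_{B - f} | B ∈ 𝓑_f}`. -/
def gaugeFamily {n : ℕ} (𝓑 : Set (Set (EuclideanSpace ℝ (Fin n))))
    (f : EuclideanSpace ℝ (Fin n)) : Set (EuclideanSpace ℝ (Fin n) → ℝ) :=
  (fun B => gaugeAt B f) '' containing 𝓑 f

/-- `𝓑` is `f`-closed: within the family `{ψ_{C - f} | C ∈ 𝒞ⁿ_f}`, with the topology of pointwise
convergence (the product topology on `ℝⁿ → ℝ`), the family `{ψ_{B - f} | B ∈ 𝓑_f}` is closed. -/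
def FClosed {n : ℕ} (f : EuclideanSpace ℝ (Fin n))
    (𝓑 : Set (Set (EuclideanSpace ℝ (Fin n)))) : Prop :=
  IsClosed (Subtype.val ⁻¹' gaugeFamily 𝓑 f : Set (gaugeFamily (bodies n) f))

/-- The cut `C_B(R, f)`, for a matrix `R` given by its columns `R 0, …, R (k - 1)` in `ℝⁿ`:
the `s ≥ 0` with `∑ sᵢ ψ_{B - f}(rᵢ) ≥ 1` if `f ∈ interior B`, and all `s ≥ 0` otherwise. -/
def cut {n k : ℕ} (B : Set (EuclideanSpace ℝ (Fin n))) (R : Fin k → EuclideanSpace ℝ (Fin n))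
    (f : EuclideanSpace ℝ (Fin n)) : Set (Fin k → ℝ) :=
  {s | (∀ i, 0 ≤ s i) ∧ (f ∈ interior B → 1 ≤ ∑ i, s i * gaugeAt B f (R i))}

/-- The closure `C_𝓑(R, f)`: the intersection of all cuts `C_B(R, f)` with `B ∈ 𝓑`, and the whole
nonnegative orthant if `𝓑` is empty (every cut lies in the orthant, so intersecting with the
orthant changes nothing for nonempty `𝓑`). -/
def cutClosure {n k : ℕ} (𝓑 : Set (Set (EuclideanSpace ℝ (Fin n))))
    (R : Fin k → EuclideanSpace ℝ (Fin n)) (f : EuclideanSpace ℝ (Fin n)) : Set (Fin k → ℝ) :=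
  {s | ∀ i, 0 ≤ s i} ∩ ⋂ B ∈ 𝓑, cut B R f

/-- `ρ_f(B, L)`, the infimum in `[0, ∞]` of all real `α > 0` with `C_B(R, f) ⊆ (1/α) C_L(R, f)` for
all matrices `R` with `n` rows and at least one column. -/
noncomputable def rhoSet {n : ℕ} (f : EuclideanSpace ℝ (Fin n))
    (B L : Set (EuclideanSpace ℝ (Fin n))) : ENNReal :=
  sInf (ENNReal.ofReal '' {α : ℝ | 0 < α ∧
    ∀ k : ℕ, 0 < k → ∀ R : Fin k → EuclideanSpace ℝ (Fin n), cut B R f ⊆ (1 / α) • cut L R f})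

/-- `ρ_f(𝓑, L)`, the infimum in `[0, ∞]` of all real `α > 0` with `C_𝓑(R, f) ⊆ (1/α) C_L(R, f)` for
all matrices `R` with `n` rows and at least one column. -/
noncomputable def rhoFamily {n : ℕ} (f : EuclideanSpace ℝ (Fin n))
    (𝓑 : Set (Set (EuclideanSpace ℝ (Fin n)))) (L : Set (EuclideanSpace ℝ (Fin n))) : ENNReal :=
  sInf (ENNReal.ofReal '' {α : ℝ | 0 < α ∧
    ∀ k : ℕ, 0 < k → ∀ R : Fin k → EuclideanSpace ℝ (Fin n),
      cutClosure 𝓑 R f ⊆ (1 / α) • cut L R f})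

end OneForAll

open Filter Topology

namespace OneForAll

/-! The upper bound holds because the closure lies in each cut. For the lower bound let `f` be
interior to `L`, let `α` be admissible for the family and put β = (|V|+|W|+1)α. For every m some
body `B` has gauge at most β at each v - f and at most 1/(m+1) at each w. Otherwise the weights 1/β
on the v - f and m+1 on the w satisfy every cut, while their `L`-value is at most |V|/β < 1/α, as
the gauge of `L` vanishes on `W` (`one_le_mul_sum`). These gauges are pointwise bounded, so by
Tychonoff they have an ultrafilter limit. It is sublinear, hence the gauge of a body, and
f-closedness puts it in the family (`exists_mem_containing_of_forall_nat`). The limit vanishes on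
`W` and is at most β on `L` - `f`, so one body has ratio at most β (`exists_rhoSet_le`). -/

/-- Nonnegative sublinear real functions. -/
structure IsSublinear {E : Type*} [AddCommGroup E] [Module ℝ E] (p : E → ℝ) : Prop where
  nonneg : ∀ x, 0 ≤ p x
  add_le : ∀ x y, p (x + y) ≤ p x + p y
  smul : ∀ t : ℝ, 0 ≤ t → ∀ x, p (t • x) = t * p x

/-! ### Sublinear functions -/

namespace IsSublinear

variable {E : Type*} [AddCommGroup E] [Module ℝ E] {p : E → ℝ}

theorem map_zero (hp : IsSublinear p) : p 0 = 0 := by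
  simpa using hp.smul 0 le_rfl 0

theorem convexOn (hp : IsSublinear p) : ConvexOn ℝ Set.univ p := by
  refine ⟨convex_univ, fun x _ y _ a b ha hb _ => ?_⟩
  simpa [hp.smul a ha, hp.smul b hb] using hp.add_le (a • x) (b • y)

theorem convex_translate_le (hp : IsSublinear p) (f : E) (a : ℝ) :
    Convex ℝ {x | p (x - f) ≤ a} := by
  have h := (hp.convexOn.convex_le a).translate_preimage_right (-f)
  convert h using 1
  ext x
  simp [sub_eq_neg_add]

theorem gauge_sublevel (hp : IsSublinear p) (r : E) : gauge {x | p x ≤ 1} r = p r := by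
  have key : ∀ t : ℝ, 0 < t → (r ∈ t • {x | p x ≤ 1} ↔ p r ≤ t) := fun t ht => by
    rw [Set.mem_smul_set_iff_inv_smul_mem₀ ht.ne', Set.mem_ofPred_eq,
      hp.smul _ (inv_nonneg.2 ht.le), inv_mul_le_iff₀ ht, mul_one]
  have hpos := hp.nonneg r
  refine le_antisymm (le_of_forall_pos_le_add fun ε hε => ?_) ?_
  · exact gauge_le_of_mem (by positivity) ((key _ (by positivity)).2 (by linarith))
  · refine le_csInf ⟨p r + 1, by positivity, (key _ (by positivity)).2 (by linarith)⟩ ?_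
    rintro t ⟨ht, hr⟩
    exact (key t ht).1 hr

/-- The constant `D` depends on the point only, not on `p`: it is the total weight of a conic
representation. So b = 1 bounds a whole sequence of gauges, and b = 0 removes the recession part. -/
theorem le_on_convexHull_add_hull {V W : Set E} (f : E) {x : E}
    (hx : x ∈ convexHull ℝ V + (PointedCone.hull ℝ W : Set E)) :
    ∃ D : ℝ, 0 ≤ D ∧ ∀ p : E → ℝ, IsSublinear p → ∀ a b : ℝ,
      (∀ v ∈ V, p (v - f) ≤ a) → (∀ w ∈ W, p w ≤ b) → p (x - f) ≤ a + D * b := by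
  obtain ⟨y, hy, z, hz, rfl⟩ := hx
  have hcone : ∃ D : ℝ, 0 ≤ D ∧ ∀ p : E → ℝ, IsSublinear p → ∀ b : ℝ,
      (∀ w ∈ W, p w ≤ b) → p z ≤ D * b := by
    refine Submodule.span_induction (p := fun z _ => ∃ D : ℝ, 0 ≤ D ∧ ∀ p : E → ℝ,
      IsSublinear p → ∀ b : ℝ, (∀ w ∈ W, p w ≤ b) → p z ≤ D * b) ?_ ?_ ?_ ?_ hz
    · exact fun w hw => ⟨1, zero_le_one, fun p _ b hb => by simpa using hb w hw⟩
    · exact ⟨0, le_rfl, fun p hp b _ => by simp [hp.map_zero]⟩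
    · rintro z₁ z₂ _ _ ⟨D₁, h₁, H₁⟩ ⟨D₂, h₂, H₂⟩
      refine ⟨D₁ + D₂, add_nonneg h₁ h₂, fun p hp b hb => ?_⟩
      linarith [hp.add_le z₁ z₂, H₁ p hp b hb, H₂ p hp b hb]
    · rintro c z _ ⟨D, hD, H⟩
      refine ⟨c * D, mul_nonneg c.2 hD, fun p hp b hb => ?_⟩
      have h := hp.smul c c.2 z
      rw [mul_assoc]
      exact h.le.trans (mul_le_mul_of_nonneg_left (H p hp b hb) c.2)
  obtain ⟨D, hD, H⟩ := hcone
  refine ⟨D, hD, fun p hp a b ha hb => ?_⟩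
  have hya : p (y - f) ≤ a := convexHull_min ha (hp.convex_translate_le f a) hy
  have hadd := hp.add_le (y - f) z
  rw [show y - f + z = y + z - f by abel] at hadd
  linarith [H p hp b hb]

theorem of_tendsto {ι : Type*} {l : Filter ι} [l.NeBot] {G : ι → E → ℝ} {q : E → ℝ}
    (hG : ∀ i, IsSublinear (G i)) (h : ∀ x, Tendsto (fun i => G i x) l (𝓝 (q x))) :
    IsSublinear q where
  nonneg x := ge_of_tendsto' (h x) fun i => (hG i).nonneg x
  add_le x y := le_of_tendsto_of_tendsto' (h (x + y)) ((h x).add (h y)) fun i => (hG i).add_le x y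
  smul t ht x := tendsto_nhds_unique (h (t • x)) <| by
    simpa only [(hG _).smul t ht x] using (h x).const_mul t

end IsSublinear

/-! ### Gauges of translated bodies -/

variable {n : ℕ} {f : EuclideanSpace ℝ (Fin n)} {B L : Set (EuclideanSpace ℝ (Fin n))}

theorem image_sub_mem_nhds (hf : f ∈ interior B) : (fun x => x - f) '' B ∈ 𝓝 0 := by
  have h : (fun x => x - f) '' B = (fun x => x + f) ⁻¹' B := by
    ext x
    simp [sub_eq_iff_eq_add]
  rw [h]
  exact (continuous_add_const f).continuousAt.preimage_mem_nhds
    (by simpa using mem_interior_iff_mem_nhds.1 hf)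

theorem isSublinear_gaugeAt (hB : Convex ℝ B) (hf : f ∈ interior B) :
    IsSublinear (gaugeAt B f) where
  nonneg x := gauge_nonneg x
  add_le := by
    have h : Convex ℝ ((fun x => x - f) '' B) := by
      simpa only [neg_add_eq_sub] using hB.translate (-f)
    exact gauge_add_le h (absorbent_nhds_zero (image_sub_mem_nhds hf))
  smul t ht x := gauge_smul_of_nonneg ht x

theorem gaugeAt_sub_le_one {x : EuclideanSpace ℝ (Fin n)} (hx : x ∈ B) :
    gaugeAt B f (x - f) ≤ 1 :=
  gauge_le_one_of_mem ⟨x, hx, rfl⟩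

theorem gaugeAt_eq_zero_of_ray {w : EuclideanSpace ℝ (Fin n)} (hB : Convex ℝ B)
    (hf : f ∈ interior B) (hw : ∀ t : ℝ, 0 ≤ t → f + t • w ∈ B) : gaugeAt B f w = 0 := by
  have hp := isSublinear_gaugeAt hB hf
  by_contra hne
  have hpos : 0 < gaugeAt B f w := lt_of_le_of_ne (hp.nonneg w) (Ne.symm hne)
  -- At this point of the ray the gauge would be 2, though it is at most 1 on the body.
  have ht : 0 ≤ 2 / gaugeAt B f w := by positivity
  have h := gaugeAt_sub_le_one (f := f) (hw _ ht)
  rw [add_sub_cancel_left, hp.smul _ ht, div_mul_cancel₀ _ hne] at h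
  norm_num at h

theorem le_mul_gaugeAt {p : EuclideanSpace ℝ (Fin n) → ℝ} (hp : IsSublinear p)
    (hf : f ∈ interior L) {β : ℝ} (hβ : 0 < β) (h : ∀ x ∈ L, p (x - f) ≤ β)
    (r : EuclideanSpace ℝ (Fin n)) : p r ≤ β * gaugeAt L f r := by
  rw [← div_le_iff₀' hβ]
  refine le_csInf (absorbent_nhds_zero (image_sub_mem_nhds hf)).gauge_set_nonempty ?_
  rintro t ⟨ht, hr⟩
  obtain ⟨_, ⟨x, hx, rfl⟩, rfl⟩ := hr
  simp only [hp.smul t (le_of_lt ht)]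
  rw [div_le_iff₀ hβ]
  exact mul_le_mul_of_nonneg_left (h x hx) (le_of_lt ht)

/-- A nonnegative sublinear function on `ℝⁿ` is the gauge of a translated body. -/
theorem IsSublinear.mem_gaugeFamily {p : EuclideanSpace ℝ (Fin n) → ℝ} (hp : IsSublinear p)
    (f : EuclideanSpace ℝ (Fin n)) : p ∈ gaugeFamily (bodies n) f := by
  have hcont : Continuous fun x => p (x - f) :=
    (continuousOn_univ.1 (hp.convexOn.continuousOn isOpen_univ)).comp
      (continuous_id.sub continuous_const)
  have hint : f ∈ interior {x | p (x - f) ≤ 1} := by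
    refine interior_maximal (s := {x | p (x - f) ≤ 1}) (t := {x | p (x - f) < 1})
      (Set.ofPred_subset_ofPred.2 fun x hx => hx.le) (isOpen_lt hcont continuous_const) ?_
    simp [hp.map_zero]
  refine ⟨{x | p (x - f) ≤ 1}, ⟨⟨isClosed_le hcont continuous_const,
    hp.convex_translate_le f 1, ?_⟩, hint⟩, ?_⟩
  · exact (hp.convex_translate_le f 1).interior_nonempty_iff_affineSpan_eq_top.1 ⟨f, hint⟩
  · have himage : (fun x => x - f) '' {x | p (x - f) ≤ 1} = {x | p x ≤ 1} := by
      ext x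
      constructor
      · rintro ⟨y, hy, rfl⟩
        exact hy
      · exact fun hx => ⟨x + f, by simpa using hx, by simp⟩
    funext r
    change gauge ((fun x => x - f) '' {x | p (x - f) ≤ 1}) r = p r
    rw [himage, hp.gauge_sublevel]

/-! ### Pointwise limits of gauges -/

theorem FClosed.mem_of_tendsto {𝓑 : Set (Set (EuclideanSpace ℝ (Fin n)))}
    (h𝓑 : 𝓑 ⊆ bodies n) (hclosed : FClosed f 𝓑) {ι : Type*} {l : Filter ι} [l.NeBot]
    {G : ι → EuclideanSpace ℝ (Fin n) → ℝ} {q : EuclideanSpace ℝ (Fin n) → ℝ}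
    (hG : ∀ i, G i ∈ gaugeFamily 𝓑 f) (hq : q ∈ gaugeFamily (bodies n) f)
    (h : Tendsto G l (𝓝 q)) : q ∈ gaugeFamily 𝓑 f := by
  have hG' : ∀ i, G i ∈ gaugeFamily (bodies n) f := fun i => by
    obtain ⟨B, hB, hBG⟩ := hG i
    exact ⟨B, ⟨h𝓑 hB.1, hB.2⟩, hBG⟩
  have hlim : Tendsto (fun i => (⟨G i, hG' i⟩ : gaugeFamily (bodies n) f)) l (𝓝 ⟨q, hq⟩) :=
    tendsto_subtype_rng.2 h
  exact IsClosed.mem_of_tendsto (s := Subtype.val ⁻¹' gaugeFamily 𝓑 f) hclosed hlim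
    (Eventually.of_forall hG)

theorem exists_ultrafilter_tendsto {X : Type*} {G : ℕ → X → ℝ}
    (hG : ∀ x, ∃ C, ∀ m, G m x ∈ Set.Icc 0 C) :
    ∃ q : X → ℝ, Tendsto G (hyperfilter ℕ : Filter ℕ) (𝓝 q) := by
  choose C hC using hG
  have hcpt : IsCompact (Set.univ.pi fun x => Set.Icc 0 (C x)) :=
    isCompact_univ_pi fun x => isCompact_Icc
  obtain ⟨q, -, hq⟩ := hcpt.ultrafilter_le_nhds ((hyperfilter ℕ).map G)
    (le_principal_iff.2 (Ultrafilter.mem_map.2 (univ_mem' fun m => Set.mem_univ_pi.2 fun x => hC x m)))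
  exact ⟨q, hq⟩

/-! ### Comparing cuts -/

theorem rhoSet_le (hfB : f ∈ interior B) {β : ℝ} (hβ : 0 < β)
    (h : ∀ r, gaugeAt B f r ≤ β * gaugeAt L f r) : rhoSet f B L ≤ ENNReal.ofReal β := by
  refine sInf_le ⟨β, ⟨hβ, fun k _ R s hs => ?_⟩, rfl⟩
  refine ⟨β • s, ⟨fun i => mul_nonneg hβ.le (hs.1 i), fun _ => ?_⟩, ?_⟩
  · refine (hs.2 hfB).trans (Finset.sum_le_sum fun i _ => ?_)
    have := mul_le_mul_of_nonneg_left (h (R i)) (hs.1 i)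
    simp only [Pi.smul_apply, smul_eq_mul]
    linarith
  · simp [smul_smul, hβ.ne']

theorem subset_smul_cut_of_notMem_interior (hf : f ∉ interior L) {k : ℕ}
    (R : Fin k → EuclideanSpace ℝ (Fin n)) {α : ℝ} (hα : 0 < α) {S : Set (Fin k → ℝ)}
    (hS : ∀ s ∈ S, ∀ i, 0 ≤ s i) : S ⊆ (1 / α) • cut L R f := fun s hs =>
  ⟨α • s, ⟨fun i => mul_nonneg hα.le (hS s hs i), fun h => absurd h hf⟩, by
    simp [smul_smul, hα.ne']⟩

theorem rhoSet_eq_zero_of_notMem_interior (hf : f ∉ interior L) : rhoSet f B L = 0 := by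
  refine le_antisymm (ENNReal.le_of_forall_pos_le_add fun ε hε _ => ?_) bot_le
  rw [zero_add]
  refine sInf_le ⟨ε, ⟨hε, fun k _ R => ?_⟩, ENNReal.ofReal_coe_nnreal⟩
  exact subset_smul_cut_of_notMem_interior hf R hε fun s hs => hs.1

theorem rhoFamily_le_rhoSet {𝓑 : Set (Set (EuclideanSpace ℝ (Fin n)))} (hB : B ∈ 𝓑) :
    rhoFamily f 𝓑 L ≤ rhoSet f B L := by
  refine sInf_le_sInf (Set.image_mono fun α hα => ⟨hα.1, fun k hk R => ?_⟩)
  refine Set.Subset.trans (fun s hs => ?_) (hα.2 k hk R)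
  exact Set.mem_iInter₂.1 hs.2 B hB

/-- If `α` is admissible for the family, then weights whose cut inequality holds for every member
of the family satisfy the inequality of `L` up to the factor `α`. -/
theorem one_le_mul_sum {𝓑 : Set (Set (EuclideanSpace ℝ (Fin n)))} {ι : Type*} [Fintype ι]
    [Nonempty ι] (hf : f ∈ interior L) {α : ℝ} (hα : 0 < α)
    (h : ∀ k : ℕ, 0 < k → ∀ R : Fin k → EuclideanSpace ℝ (Fin n),
      cutClosure 𝓑 R f ⊆ (1 / α) • cut L R f)
    (R : ι → EuclideanSpace ℝ (Fin n)) (s : ι → ℝ) (hs : ∀ i, 0 ≤ s i)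
    (hcut : ∀ B ∈ containing 𝓑 f, 1 ≤ ∑ i, s i * gaugeAt B f (R i)) :
    1 ≤ α * ∑ i, s i * gaugeAt L f (R i) := by
  let e := Fintype.equivFin ι
  have hmem : s ∘ e.symm ∈ cutClosure 𝓑 (R ∘ e.symm) f := by
    refine ⟨fun i => hs _, Set.mem_iInter₂.2 fun B hB => ⟨fun i => hs _, fun hfB => ?_⟩⟩
    refine (hcut B ⟨hB, hfB⟩).trans_eq ?_
    exact (e.symm.sum_comp fun i => s i * gaugeAt B f (R i)).symm
  obtain ⟨u, hu, hus⟩ := h _ Fintype.card_pos _ hmem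
  have hu' : ∀ i, u i = α * s (e.symm i) := fun i => by
    have := congrFun hus i
    simp only [Pi.smul_apply, smul_eq_mul, Function.comp_apply] at this
    rw [← this]
    field_simp
  refine (hu.2 hf).trans_eq ?_
  rw [← e.symm.sum_comp fun i => s i * gaugeAt L f (R i), Finset.mul_sum]
  exact Finset.sum_congr rfl fun i _ => by rw [hu', mul_assoc]; rfl

/-! ### Compactness and the choice of one body -/

/-- A family of gauges that is bounded at the generators of `L` and tends to zero on the
recession directions has a limit among the gauges of an `f`-closed family. -/
theorem exists_mem_containing_of_forall_nat {𝓑 : Set (Set (EuclideanSpace ℝ (Fin n)))}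
    (h𝓑 : 𝓑 ⊆ bodies n) (hclosed : FClosed f 𝓑) {V W : Set (EuclideanSpace ℝ (Fin n))}
    (hf : f ∈ interior (convexHull ℝ V +
      (PointedCone.hull ℝ W : Set (EuclideanSpace ℝ (Fin n))))) {β : ℝ}
    (h : ∀ m : ℕ, ∃ B ∈ containing 𝓑 f, (∀ v ∈ V, gaugeAt B f (v - f) ≤ β) ∧
      ∀ w ∈ W, gaugeAt B f w ≤ 1 / ((m : ℝ) + 1)) :
    ∃ B ∈ containing 𝓑 f, (∀ v ∈ V, gaugeAt B f (v - f) ≤ β) ∧ ∀ w ∈ W, gaugeAt B f w ≤ 0 := by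
  choose B hB hV hW using h
  have hsub : ∀ m, IsSublinear (gaugeAt (B m) f) := fun m =>
    isSublinear_gaugeAt (h𝓑 (hB m).1).2.1 (hB m).2
  have hbdd : ∀ r, ∃ C, ∀ m, gaugeAt (B m) f r ∈ Set.Icc 0 C := by
    intro r
    -- Since `f` is interior, a short step along `r` stays in the polyhedron, where the generators
    -- control every gauge.
    obtain ⟨ε, hε, hmem⟩ : ∃ ε : ℝ, 0 < ε ∧ f + ε • r ∈ convexHull ℝ V +
        (PointedCone.hull ℝ W : Set (EuclideanSpace ℝ (Fin n))) := by
      have hc : Tendsto (fun t : ℝ => f + t • r) (𝓝[>] 0) (𝓝 f) := by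
        have : Continuous fun t : ℝ => f + t • r := by fun_prop
        simpa using (this.tendsto 0).mono_left nhdsWithin_le_nhds
      obtain ⟨ε, h₁, h₂⟩ := ((hc.eventually (mem_interior_iff_mem_nhds.1 hf)).and
        self_mem_nhdsWithin).exists
      exact ⟨ε, h₂, h₁⟩
    obtain ⟨D, hD, H⟩ := IsSublinear.le_on_convexHull_add_hull f hmem
    refine ⟨(β + D * 1) / ε, fun m => ⟨(hsub m).nonneg r, ?_⟩⟩
    have := H _ (hsub m) β 1 (hV m) fun w hw => (hW m w hw).trans <| by
      rw [div_le_one (by positivity)]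
      linarith [(Nat.cast_nonneg m : (0 : ℝ) ≤ m)]
    rw [add_sub_cancel_left, (hsub m).smul ε hε.le] at this
    rwa [le_div_iff₀' hε]
  obtain ⟨q, hq⟩ := exists_ultrafilter_tendsto hbdd
  have hpt := tendsto_pi_nhds.1 hq
  obtain ⟨C, hC, rfl⟩ := hclosed.mem_of_tendsto h𝓑 (fun m => ⟨B m, hB m, rfl⟩)
    ((IsSublinear.of_tendsto hsub hpt).mem_gaugeFamily f) hq
  refine ⟨C, hC, fun v hv => le_of_tendsto' (hpt _) fun m => hV m v hv, fun w hw => ?_⟩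
  exact le_of_tendsto_of_tendsto' (hpt w)
    (tendsto_one_div_add_atTop_nhds_zero_nat.mono_left Nat.hyperfilter_le_atTop)
    fun m => hW m w hw

theorem exists_rhoSet_le {𝓑 : Set (Set (EuclideanSpace ℝ (Fin n)))}
    (h𝓑 : 𝓑 ⊆ bodies n) (hclosed : FClosed f 𝓑)
    {V W : Finset (EuclideanSpace ℝ (Fin n))} (hV : V.Nonempty)
    (hL : Convex ℝ L)
    (hLVW : L = convexHull ℝ (V : Set (EuclideanSpace ℝ (Fin n))) +
      (PointedCone.hull ℝ (W : Set (EuclideanSpace ℝ (Fin n))) : Set (EuclideanSpace ℝ (Fin n))))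
    (hf : f ∈ interior L) {α : ℝ} (hα : 0 < α)
    (h : ∀ k : ℕ, 0 < k → ∀ R : Fin k → EuclideanSpace ℝ (Fin n),
      cutClosure 𝓑 R f ⊆ (1 / α) • cut L R f) :
    ∃ B ∈ 𝓑, rhoSet f B L ≤ ENNReal.ofReal (((V.card : ℝ) + W.card + 1) * α) := by
  -- The summand 1 makes α|V|/β < 1 strict even when `W` is empty.
  set β : ℝ := ((V.card : ℝ) + W.card + 1) * α with hβdef
  have hβ : 0 < β := by positivity
  have hVL : ∀ v ∈ V, gaugeAt L f (v - f) ≤ 1 := fun v hv => by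
    refine gaugeAt_sub_le_one ?_
    rw [hLVW]
    exact ⟨v, subset_convexHull ℝ _ hv, 0, zero_mem _, add_zero v⟩
  have hWL : ∀ w ∈ W, gaugeAt L f w = 0 := fun w hw => by
    refine gaugeAt_eq_zero_of_ray hL hf fun t ht => ?_
    have hfL := interior_subset hf
    rw [hLVW] at hfL ⊢
    obtain ⟨y, hy, z, hz, hyz⟩ := hfL
    refine ⟨y, hy, z + t • w, add_mem hz ?_, by rw [← hyz]; exact (add_assoc y z _).symm⟩
    exact Submodule.smul_mem _ (⟨t, ht⟩ : {c : ℝ // 0 ≤ c}) (Submodule.subset_span hw)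
  have hseq : ∀ m : ℕ, ∃ B ∈ containing 𝓑 f,
      (∀ v ∈ (V : Set (EuclideanSpace ℝ (Fin n))), gaugeAt B f (v - f) ≤ β) ∧
      ∀ w ∈ (W : Set (EuclideanSpace ℝ (Fin n))), gaugeAt B f w ≤ 1 / ((m : ℝ) + 1) := by
    intro m
    have hm : (0 : ℝ) < (m : ℝ) + 1 := by positivity
    by_contra! hcon
    have : Nonempty V := hV.to_subtype
    have key := one_le_mul_sum (ι := V ⊕ W) hf hα h
      (Sum.elim (fun v => (v : EuclideanSpace ℝ (Fin n)) - f) fun w => w)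
      (Sum.elim (fun _ => 1 / β) fun _ => (m : ℝ) + 1)
      (by rintro (_ | _) <;> simp only [Sum.elim_inl, Sum.elim_inr] <;> positivity) ?_
    · simp only [Fintype.sum_sum_type, Sum.elim_inl, Sum.elim_inr] at key
      have h₁ : ∑ v : V, 1 / β * gaugeAt L f ((v : EuclideanSpace ℝ (Fin n)) - f) ≤
          V.card * (1 / β) := by
        refine (Finset.sum_le_card_nsmul _ _ (1 / β) fun v _ => ?_).trans_eq (by simp)
        exact mul_le_of_le_one_right (by positivity) (hVL v v.2)
      have h₂ : ∑ w : W, ((m : ℝ) + 1) * gaugeAt L f (w : EuclideanSpace ℝ (Fin n)) = 0 :=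
        Finset.sum_eq_zero fun w _ => by rw [hWL w w.2, mul_zero]
      rw [h₂, add_zero] at key
      have h₃ : α * (V.card * (1 / β)) < 1 := by
        rw [← mul_assoc, mul_one_div, div_lt_one hβ, hβdef, mul_comm]
        refine mul_lt_mul_of_pos_right ?_ hα
        linarith [(Nat.cast_nonneg W.card : (0 : ℝ) ≤ W.card)]
      linarith [mul_le_mul_of_nonneg_left h₁ hα.le]
    · intro B hB
      have hp := isSublinear_gaugeAt (h𝓑 hB.1).2.1 hB.2
      have hterm : ∀ i : V ⊕ W, 0 ≤ Sum.elim (fun _ : V => 1 / β) (fun _ : W => (m : ℝ) + 1) i *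
          gaugeAt B f (Sum.elim (fun v : V => (v : EuclideanSpace ℝ (Fin n)) - f)
            (fun w : W => w) i) := fun i => mul_nonneg (by
          rcases i with _ | _ <;> simp only [Sum.elim_inl, Sum.elim_inr] <;> positivity) (hp.nonneg _)
      -- Each `B` exceeds a threshold at some generator, and the weights are the reciprocal
      -- thresholds, so that single term already reaches 1.
      have hle := fun i => Finset.single_le_sum (fun j _ => hterm j) (Finset.mem_univ i)
      by_cases hvB : ∀ v ∈ (V : Set (EuclideanSpace ℝ (Fin n))), gaugeAt B f (v - f) ≤ β
      · obtain ⟨w, hw, hlt⟩ := hcon B hB hvB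
        refine le_trans ?_ (hle (Sum.inr ⟨w, hw⟩))
        simp only [Sum.elim_inr]
        rw [div_lt_iff₀' hm] at hlt
        exact hlt.le
      · push Not at hvB
        obtain ⟨v, hv, hlt⟩ := hvB
        refine le_trans ?_ (hle (Sum.inl ⟨v, hv⟩))
        simp only [Sum.elim_inl]
        rw [one_div, inv_mul_eq_div, one_le_div hβ]
        exact hlt.le
  obtain ⟨B, hB, hBV, hBW⟩ :=
    exists_mem_containing_of_forall_nat h𝓑 hclosed (hLVW ▸ hf) hseq
  have hp := isSublinear_gaugeAt (h𝓑 hB.1).2.1 hB.2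
  refine ⟨B, hB.1, rhoSet_le hB.2 hβ (le_mul_gaugeAt hp hf hβ fun x hx => ?_)⟩
  rw [hLVW] at hx
  obtain ⟨D, -, H⟩ := IsSublinear.le_on_convexHull_add_hull f hx
  simpa using H _ hp β 0 hBV hBW

end OneForAll


theorem theorem4p2 (n : ℕ) (f : EuclideanSpace ℝ (Fin n))
    (hf : f ∉ OneForAll.integerPoints n)
    (𝓑 : Set (Set (EuclideanSpace ℝ (Fin n)))) (h𝓑 : 𝓑 ⊆ OneForAll.bodies n)
    (hclosed : OneForAll.FClosed f 𝓑)
    (V W : Finset (EuclideanSpace ℝ (Fin n))) (hV : V.Nonempty) (hW : 0 ∉ W)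
    (L : Set (EuclideanSpace ℝ (Fin n))) (hL : L ∈ OneForAll.bodies n)
    (hLVW : L = convexHull ℝ (V : Set (EuclideanSpace ℝ (Fin n))) +
      (PointedCone.hull ℝ (W : Set (EuclideanSpace ℝ (Fin n))) : Set (EuclideanSpace ℝ (Fin n))))
    (hne : 𝓑.Nonempty ∨ f ∈ interior L) :
    1 / ((V.card : ENNReal) + (W.card : ENNReal) + 1) * (⨅ B ∈ 𝓑, OneForAll.rhoSet f B L)
        ≤ OneForAll.rhoFamily f 𝓑 L ∧
      OneForAll.rhoFamily f 𝓑 L ≤ ⨅ B ∈ 𝓑, OneForAll.rhoSet f B L := by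

  refine ⟨?_, le_iInf₂ fun B hB => OneForAll.rhoFamily_le_rhoSet hB⟩
  by_cases hfL : f ∈ interior L
  · refine le_sInf ?_
    rintro _ ⟨α, ⟨hα, h⟩, rfl⟩
    obtain ⟨B, hB, hρ⟩ := OneForAll.exists_rhoSet_le h𝓑 hclosed hV hL.2.1 hLVW hfL hα h
    have hcast : ENNReal.ofReal (((V.card : ℝ) + W.card + 1) * α) =
        ((V.card : ENNReal) + W.card + 1) * ENNReal.ofReal α := by
      rw [ENNReal.ofReal_mul (by positivity), ENNReal.ofReal_add (by positivity) zero_le_one,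
        ENNReal.ofReal_add (by positivity) (by positivity)]
      simp
    rw [one_div, ENNReal.inv_mul_le_iff (by simp) (by finiteness), ← hcast]
    exact (iInf₂_le B hB).trans hρ
  · obtain ⟨B, hB⟩ := hne.resolve_right hfL
    have hzero : (⨅ B ∈ 𝓑, OneForAll.rhoSet f B L) = 0 := le_antisymm
      ((iInf₂_le B hB).trans_eq (OneForAll.rhoSet_eq_zero_of_notMem_interior hfL)) bot_le
    rw [hzero, mul_zero]
    exact bot_le
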